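/- **Setting.** Consider the second-order language with identity that has individual variables and, for each $n\ge 1$, variables for $n$-ary predicates. A *predicate structure* consists of a non-empty set $I$ of individuals and, for each $n\ge1$, a non-empty set $J_n$ of $n$-ary predicates on $I$; individual quantifiers range over $I$ and quantifiers over $n$-ary predicates range over $J_n$. It is a *Henkin structure* if it satisfies comprehension: for every formula $H$, every $n\ge 1$, all pairwise distinct individual variables $x_1,\dots,x_n$ and every assignment $f$, the predicate $\{(\xi_1,\dots,\xi_n)\in I^n : H \text{ is true under } f\langle x_1/\xi_1,\dots,x_n/\xi_n\rangle\}$ belongs to $J_n$. A structure is a model of a formula if the formula is true in it under all assignments. A formula $\varphi$ is *HPL-independent* from a set $\Gamma$ of formulas if neither $\varphi$ nor $\neg\varphi$ is a consequence of $\Gamma$ in second-order predicate logic with Henkin interpretation, i.e. neither of them holds in all Henkin structures that are models of $\Gamma$. For $n,m\ge1$, tuples $\boldsymbol x=(x_1,\dots,x_n)$, $\boldsymbol y=(y_1,\dots,y_m)$ of pairwise distinct individual variables, an $m$-ary predicate variable $D$, an $(n+m)$-ary predicate variable $S$, and a second-order formula $H$ (possibly with further free variables) in which $\boldsymbol x$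 and $D$ do not occur bound and $S$ does not occur free, the corresponding $n$-$m$ *Ackermann axiom of choice* is $$\forall \boldsymbol x\,\exists D\, H(\boldsymbol x,D)\ \to\ \exists S\,\forall\boldsymbol x\,\exists D\,\bigl(\forall \boldsymbol y\,(D\boldsymbol y\leftrightarrow S\boldsymbol x\boldsymbol y)\wedge H(\boldsymbol x,D)\bigr).$$ Let $choice_h^{(2)}$ be the set of all these axioms, for all $n,m\ge1$. For $n\ge1$, let $TR^n$ be the sentence $\forall A\,\forall B\,([A\lesssim B]\vee[B\lesssim A])$, where $A,B$ are $n$-ary predicate variables and $[A\lesssim B]$ expresses that there is a $2n$-ary predicate that is the graph of a one-to-one function of $A$ into $B$. **Theorem.** For every $n\ge1$, $TR^n$ is HPL-independent from $choice_h^{(2)}$. -/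

import Mathlib

namespace HPL

/-- Second-order formulas with identity. There is one sort of individual variables, numbered by `ℕ`,
and for each arity `n ≥ 1` one sort of `n`-ary predicate variables, numbered by `ℕ` as well. -/
inductive Formula : Type
  | eq (x y : ℕ) : Formula
  | predEq (n : ℕ+) (A B : ℕ) : Formula
  | app (n : ℕ+) (A : ℕ) (x : Fin n → ℕ) : Formula
  | neg (φ : Formula) : Formula
  | and (φ ψ : Formula) : Formula
  | or (φ ψ : Formula) : Formula
  | imp (φ ψ : Formula) : Formula
  | iff (φ ψ : Formula) : Formula
  | all (x : ℕ) (φ : Formula) : Formula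
  | ex (x : ℕ) (φ : Formula) : Formula
  | allPred (n : ℕ+) (A : ℕ) (φ : Formula) : Formula
  | exPred (n : ℕ+) (A : ℕ) (φ : Formula) : Formula

namespace Formula

/-- The individual variable `v` occurs bound in the formula. -/
def BoundInd (v : ℕ) : Formula → Prop
  | eq _ _ => False
  | predEq _ _ _ => False
  | app _ _ _ => False
  | neg φ => φ.BoundInd v
  | and φ ψ => φ.BoundInd v ∨ ψ.BoundInd v
  | or φ ψ => φ.BoundInd v ∨ ψ.BoundInd v
  | imp φ ψ => φ.BoundInd v ∨ ψ.BoundInd v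
  | iff φ ψ => φ.BoundInd v ∨ ψ.BoundInd v
  | all x φ => x = v ∨ φ.BoundInd v
  | ex x φ => x = v ∨ φ.BoundInd v
  | allPred _ _ φ => φ.BoundInd v
  | exPred _ _ φ => φ.BoundInd v

/-- The `k`-ary predicate variable with number `V` occurs bound in the formula. -/
def BoundPred (k : ℕ+) (V : ℕ) : Formula → Prop
  | eq _ _ => False
  | predEq _ _ _ => False
  | app _ _ _ => False
  | neg φ => φ.BoundPred k V
  | and φ ψ => φ.BoundPred k V ∨ ψ.BoundPred k V
  | or φ ψ => φ.BoundPred k V ∨ ψ.BoundPred k V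
  | imp φ ψ => φ.BoundPred k V ∨ ψ.BoundPred k V
  | iff φ ψ => φ.BoundPred k V ∨ ψ.BoundPred k V
  | all _ φ => φ.BoundPred k V
  | ex _ φ => φ.BoundPred k V
  | allPred n A φ => (n = k ∧ A = V) ∨ φ.BoundPred k V
  | exPred n A φ => (n = k ∧ A = V) ∨ φ.BoundPred k V

/-- The `k`-ary predicate variable with number `V` occurs free in the formula. -/
def FreePred (k : ℕ+) (V : ℕ) : Formula → Prop
  | eq _ _ => False
  | predEq n A B => n = k ∧ (A = V ∨ B = V)
  | app n A _ => n = k ∧ A = V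
  | neg φ => φ.FreePred k V
  | and φ ψ => φ.FreePred k V ∨ ψ.FreePred k V
  | or φ ψ => φ.FreePred k V ∨ ψ.FreePred k V
  | imp φ ψ => φ.FreePred k V ∨ ψ.FreePred k V
  | iff φ ψ => φ.FreePred k V ∨ ψ.FreePred k V
  | all _ φ => φ.FreePred k V
  | ex _ φ => φ.FreePred k V
  | allPred n A φ => ¬(n = k ∧ A = V) ∧ φ.FreePred k V
  | exPred n A φ => ¬(n = k ∧ A = V) ∧ φ.FreePred k V

/-- `∀ x₁ … ∀ xₙ φ`. -/
def allTuple {n : ℕ} (x : Fin n → ℕ) (φ : Formula) : Formula :=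
  (List.ofFn x).foldr all φ

/-- `∃ x₁ … ∃ xₙ φ`. -/
def exTuple {n : ℕ} (x : Fin n → ℕ) (φ : Formula) : Formula :=
  (List.ofFn x).foldr ex φ

/-- `x₁ = y₁ ∧ … ∧ xₙ = yₙ` (followed by a trivially true conjunct). -/
def eqTuple {n : ℕ} (x y : Fin n → ℕ) : Formula :=
  (List.ofFn fun i => eq (x i) (y i)).foldr and (eq 0 0)

/-- The atomic formula `S x₁ … xₙ y₁ … yₘ` for an `(n + m)`-ary predicate variable `S`. -/
def app₂ (n m : ℕ+) (S : ℕ) (x : Fin n → ℕ) (y : Fin m → ℕ) : Formula :=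
  app (n + m) S fun i => Fin.append x y (Fin.cast (PNat.add_coe n m) i)

end Formula

/-- A predicate structure: a non-empty domain of individuals and, for each `n ≥ 1`, a non-empty set
of `n`-ary predicates on it. -/
structure PredStructure where
  Dom : Type
  nonempty_dom : Nonempty Dom
  J : ∀ n : ℕ+, Set ((Fin n → Dom) → Prop)
  nonempty_J : ∀ n, (J n).Nonempty

/-- An assignment in a predicate structure. -/
structure Assignment (M : PredStructure) where
  ind : ℕ → M.Dom
  pred : ∀ n : ℕ+, ℕ → M.J n

namespace Assignment

variable {M : PredStructure}

/-- The assignment that maps `x` to `ξ` and agrees with `f` otherwise. -/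
def setInd (f : Assignment M) (x : ℕ) (ξ : M.Dom) : Assignment M :=
  ⟨Function.update f.ind x ξ, f.pred⟩

/-- The assignment that maps the `n`-ary predicate variable with number `A` to `α` and agrees with
`f` otherwise. -/
def setPred (f : Assignment M) (n : ℕ+) (A : ℕ) (α : M.J n) : Assignment M :=
  ⟨f.ind, Function.update f.pred n (Function.update (f.pred n) A α)⟩

/-- For pairwise distinct variables `x₁, …, xₙ`: the assignment that maps each `xᵢ` to `ξᵢ` and
agrees with `f` otherwise. -/
noncomputable def setTuple (f : Assignment M) {n : ℕ} (x : Fin n → ℕ) (ξ : Fin n → M.Dom) :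
    Assignment M :=
  ⟨Function.extend x ξ f.ind, f.pred⟩

end Assignment

namespace PredStructure

/-- Truth of a formula in a predicate structure under an assignment. Predicate quantifiers range
over the predicates of the structure. -/
def Sat (M : PredStructure) : Formula → Assignment M → Prop
  | .eq x y, f => f.ind x = f.ind y
  | .predEq n A B, f => f.pred n A = f.pred n B
  | .app n A x, f => (f.pred n A).1 fun i => f.ind (x i)
  | .neg φ, f => ¬ M.Sat φ f
  | .and φ ψ, f => M.Sat φ f ∧ M.Sat ψ f
  | .or φ ψ, f => M.Sat φ f ∨ M.Sat ψ f
  | .imp φ ψ, f => M.Sat φ f → M.Sat ψ f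
  | .iff φ ψ, f => (M.Sat φ f ↔ M.Sat ψ f)
  | .all x φ, f => ∀ ξ : M.Dom, M.Sat φ (f.setInd x ξ)
  | .ex x φ, f => ∃ ξ : M.Dom, M.Sat φ (f.setInd x ξ)
  | .allPred n A φ, f => ∀ α : M.J n, M.Sat φ (f.setPred n A α)
  | .exPred n A φ, f => ∃ α : M.J n, M.Sat φ (f.setPred n A α)

/-- `M ⊨ φ`: the formula is true in `M` under all assignments. -/
def Valid (M : PredStructure) (φ : Formula) : Prop :=
  ∀ f : Assignment M, M.Sat φ f

/-- `M` is a Henkin structure: all predicates that are definable by a second-order formula, with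
individuals and predicates of `M` as parameters, belong to `M` (comprehension). -/
def IsHenkin (M : PredStructure) : Prop :=
  ∀ (n : ℕ+) (x : Fin n → ℕ), Function.Injective x → ∀ (φ : Formula) (f : Assignment M),
    (fun ξ : Fin n → M.Dom => M.Sat φ (f.setTuple x ξ)) ∈ M.J n

end PredStructure

/-- `φ` follows from `Γ` in second-order predicate logic with Henkin interpretation: each Henkin
structure that is a model of `Γ` is a model of `φ`. -/
def Consequence (Γ : Set Formula) (φ : Formula) : Prop :=
  ∀ M : PredStructure, M.IsHenkin → (∀ γ ∈ Γ, M.Valid γ) → M.Valid φ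

/-- `φ` is HPL-independent from `Γ`: neither `φ` nor its negation follows from `Γ`. -/
def Independent (φ : Formula) (Γ : Set Formula) : Prop :=
  ¬ Consequence Γ φ ∧ ¬ Consequence Γ (.neg φ)

/-- The formula
`∀ x ∃ D H(x, D) → ∃ S ∀ x ∃ D (∀ y (D y ↔ S x y) ∧ H(x, D))`,
where `D` is `m`-ary and `S` is `(n + m)`-ary. -/
def ackermann (n m : ℕ+) (x : Fin n → ℕ) (y : Fin m → ℕ) (D S : ℕ) (H : Formula) : Formula :=
  .imp (.allTuple x (.exPred m D H))
    (.exPred (n + m) S (.allTuple x (.exPred m D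
      (.and (.allTuple y (.iff (.app m D y) (.app₂ n m S x y))) H))))

/-- The `n`-`m` Ackermann axioms of choice. The variables `x₁, …, xₙ, y₁, …, yₘ` are pairwise
distinct, `x₁, …, xₙ` and `D` do not occur bound in `H`, and `S` does not occur free in `H`; other
free variables of `H` are allowed as parameters. -/
def choice (n m : ℕ+) : Set Formula :=
  {θ | ∃ (x : Fin n → ℕ) (y : Fin m → ℕ) (D S : ℕ) (H : Formula),
    Function.Injective x ∧ Function.Injective y ∧ (∀ i j, x i ≠ y j) ∧
    (∀ i, ¬ H.BoundInd (x i)) ∧ ¬ H.BoundPred m D ∧ ¬ H.FreePred (n + m) S ∧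
    θ = ackermann n m x y D S H}

/-- The set of all Ackermann axioms of choice. -/
def choiceAll : Set Formula :=
  ⋃ (n : ℕ+) (m : ℕ+), choice n m

/-- The formula `[A ≲ B]` for `n`-ary predicate variables `A` and `B`: there is a `2n`-ary predicate
that is (the graph of) a one-to-one function of `A` into `B`. -/
def embeds (n : ℕ+) (A B : ℕ) : Formula :=
  let x : Fin n → ℕ := fun i => i
  let y : Fin n → ℕ := fun i => n + i
  let z : Fin n → ℕ := fun i => 2 * n + i
  .exPred (n + n) 0
    (.and (.allTuple x (.allTuple y (.imp (.app₂ n n 0 x y) (.and (.app n A x) (.app n B y)))))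
    (.and (.allTuple x (.imp (.app n A x) (.exTuple y (.app₂ n n 0 x y))))
    (.and (.allTuple x (.allTuple y (.allTuple z
      (.imp (.and (.app₂ n n 0 x y) (.app₂ n n 0 x z)) (.eqTuple y z)))))
    (.allTuple x (.allTuple y (.allTuple z
      (.imp (.and (.app₂ n n 0 x z) (.app₂ n n 0 y z)) (.eqTuple x y))))))))

/-- The law of trichotomy for `n`-ary predicates: `∀ A ∀ B ([A ≲ B] ∨ [B ≲ A])`. -/
def trichotomy (n : ℕ+) : Formula :=
  .allPred n 0 (.allPred n 1 (.or (embeds n 0 1) (embeds n 1 0)))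

end HPL

/-! Two Henkin structures satisfying all Ackermann axioms decide `TR^n` differently. In the full
structure over `ℕ`, choice and comparability of cardinalities in the metatheory give the axioms and
trichotomy, since every required predicate is present.

Trichotomy fails in the two-coloured Fraenkel structure. Its individuals form two infinite colour
classes, and its predicates are those with a finite support under the colour-preserving
permutations. These permutations act as automorphisms (`sat_permAssign`), and a formula under an
assignment involves only finitely many parameters, whose supports together support what it defines
(`exists_support`); this yields comprehension. A finitely supported injection from one colour into
the other is impossible: swapping two individuals outside the support changes an argument but not
its value (`not_embeds_diagonal`).

The Ackermann axioms nevertheless hold, because they only select a predicate for each tuple of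
individuals. Outside a finite set, individuals of one colour are interchangeable. Hence it suffices
to choose for one representative per colour and to carry that choice along by transpositions
(`exists_finSupp_choice`); tuples follow by induction on their length
(`exists_finSupp_choice_tuple`). -/

namespace HPL

/-! ### Assignments and the meaning of the formulas -/

namespace Assignment

variable {M : PredStructure}

@[simp] theorem setTuple_pred (f : Assignment M) {n : ℕ} (x : Fin n → ℕ) (ξ : Fin n → M.Dom) :
    (f.setTuple x ξ).pred = f.pred := rfl

@[simp] theorem setPred_pred_self (f : Assignment M) (n : ℕ+) (A : ℕ) (α : M.J n) :
    (f.setPred n A α).pred n A = α := by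
  simp [setPred]

theorem setPred_pred_of_ne (f : Assignment M) {n k : ℕ+} {A V : ℕ} (α : M.J n)
    (h : ¬(n = k ∧ A = V)) : (f.setPred n A α).pred k V = f.pred k V := by
  by_cases hk : k = n
  · subst hk
    have : V ≠ A := fun e => h ⟨rfl, e.symm⟩
    simp [setPred, Function.update_of_ne this]
  · simp [setPred, Function.update_of_ne hk]

theorem setTuple_ind_apply (f : Assignment M) {n : ℕ} {x : Fin n → ℕ} (hx : x.Injective)
    (ξ : Fin n → M.Dom) (i : Fin n) : (f.setTuple x ξ).ind (x i) = ξ i :=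
  hx.extend_apply ξ f.ind i

theorem setTuple_ind_of_ne (f : Assignment M) {n : ℕ} {x : Fin n → ℕ} (ξ : Fin n → M.Dom)
    {v : ℕ} (h : ∀ i, x i ≠ v) : (f.setTuple x ξ).ind v = f.ind v :=
  Function.extend_apply' ξ f.ind v fun ⟨i, hi⟩ => h i hi

theorem setTuple_zero (f : Assignment M) (x : Fin 0 → ℕ) (ξ : Fin 0 → M.Dom) :
    f.setTuple x ξ = f := by
  have : Function.extend x ξ f.ind = f.ind :=
    funext fun v => Function.extend_apply' ξ f.ind v fun ⟨i, _⟩ => i.elim0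
  simp [setTuple, this]

/-- Peels one quantifier off a block; injectivity keeps the later updates from overwriting the value
at `x 0`. -/
theorem setTuple_succ (f : Assignment M) {n : ℕ} {x : Fin (n + 1) → ℕ} (hx : x.Injective)
    (ξ : Fin (n + 1) → M.Dom) :
    (f.setInd (x 0) (ξ 0)).setTuple (fun i => x i.succ) (fun i => ξ i.succ) = f.setTuple x ξ := by
  have hx' : Function.Injective fun i : Fin n => x i.succ := hx.comp (Fin.succ_injective n)
  have : ((f.setInd (x 0) (ξ 0)).setTuple (fun i => x i.succ) (fun i => ξ i.succ)).ind
      = (f.setTuple x ξ).ind := by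
    funext v
    by_cases hv : ∃ i, x i = v
    · obtain ⟨i, rfl⟩ := hv
      rw [setTuple_ind_apply f hx]
      refine Fin.cases ?_ (fun j => ?_) i
      · rw [setTuple_ind_of_ne _ _ fun j h => Fin.succ_ne_zero j (hx h)]
        simp [setInd]
      · exact setTuple_ind_apply (f.setInd (x 0) (ξ 0)) hx' (fun i => ξ i.succ) j
    · push Not at hv
      rw [setTuple_ind_of_ne _ _ hv, setTuple_ind_of_ne _ _ fun j => hv j.succ]
      simp [setInd, Function.update_of_ne (hv 0).symm]
  unfold setTuple at this ⊢
  simp only at this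
  rw [this]
  rfl

end Assignment

namespace PredStructure

variable (M : PredStructure)

theorem sat_allTuple {n : ℕ} {x : Fin n → ℕ} (hx : x.Injective) (φ : Formula)
    (f : Assignment M) :
    M.Sat (.allTuple x φ) f ↔ ∀ ξ : Fin n → M.Dom, M.Sat φ (f.setTuple x ξ) := by
  induction n generalizing f with
  | zero => simp [Formula.allTuple, Assignment.setTuple_zero]
  | succ n ih =>
    have hx' : Function.Injective fun i : Fin n => x i.succ := hx.comp (Fin.succ_injective n)
    have h : Formula.allTuple x φ = .all (x 0) (.allTuple (fun i => x i.succ) φ) := by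
      simp [Formula.allTuple, List.ofFn_succ]
    rw [h]
    simp only [Sat, ih hx']
    constructor
    · intro H ξ
      rw [← Assignment.setTuple_succ f hx]
      exact H _ _
    · intro H a ξ
      have := H (Fin.cons a ξ)
      rw [← Assignment.setTuple_succ f hx] at this
      simpa using this

theorem sat_exTuple {n : ℕ} {x : Fin n → ℕ} (hx : x.Injective) (φ : Formula)
    (f : Assignment M) :
    M.Sat (.exTuple x φ) f ↔ ∃ ξ : Fin n → M.Dom, M.Sat φ (f.setTuple x ξ) := by
  induction n generalizing f with
  | zero => simp [Formula.exTuple, Assignment.setTuple_zero]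
  | succ n ih =>
    have hx' : Function.Injective fun i : Fin n => x i.succ := hx.comp (Fin.succ_injective n)
    have h : Formula.exTuple x φ = .ex (x 0) (.exTuple (fun i => x i.succ) φ) := by
      simp [Formula.exTuple, List.ofFn_succ]
    rw [h]
    simp only [Sat, ih hx']
    constructor
    · rintro ⟨a, ξ, H⟩
      refine ⟨Fin.cons a ξ, ?_⟩
      rw [← Assignment.setTuple_succ f hx]
      simpa using H
    · rintro ⟨ξ, H⟩
      rw [← Assignment.setTuple_succ f hx] at H
      exact ⟨_, _, H⟩

theorem sat_eqTuple {n : ℕ} (x y : Fin n → ℕ) (f : Assignment M) :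
    M.Sat (.eqTuple x y) f ↔ ∀ i, f.ind (x i) = f.ind (y i) := by
  induction n with
  | zero => simp [Formula.eqTuple, Sat]
  | succ n ih =>
    have h : Formula.eqTuple x y = .and (.eq (x 0) (y 0))
        (.eqTuple (fun i => x i.succ) (fun i => y i.succ)) := by
      simp [Formula.eqTuple, List.ofFn_succ]
    rw [h, Fin.forall_fin_succ]
    simp only [Sat, ih]

/-- Truth of a formula depends on the values of finitely many variables only, and among the
predicate variables only the free ones matter. -/
theorem exists_finset_sat_congr (φ : Formula) :
    ∃ (s : Finset ℕ) (t : Finset (ℕ+ × ℕ)), (∀ p ∈ t, φ.FreePred p.1 p.2) ∧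
      ∀ f g : Assignment M, (∀ v ∈ s, f.ind v = g.ind v) →
        (∀ p ∈ t, f.pred p.1 p.2 = g.pred p.1 p.2) → (M.Sat φ f ↔ M.Sat φ g) := by
  classical
  -- The four binary connectives share one argument, with `r` the truth function of `op`.
  have binary : ∀ (op : Formula → Formula → Formula) (r : Prop → Prop → Prop) (φ ψ : Formula),
      (∀ f, M.Sat (op φ ψ) f ↔ r (M.Sat φ f) (M.Sat ψ f)) →
      (∀ k V, (op φ ψ).FreePred k V ↔ φ.FreePred k V ∨ ψ.FreePred k V) →
      (∃ (s : Finset ℕ) (t : Finset (ℕ+ × ℕ)), (∀ p ∈ t, φ.FreePred p.1 p.2) ∧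
      ∀ f g : Assignment M, (∀ v ∈ s, f.ind v = g.ind v) →
        (∀ p ∈ t, f.pred p.1 p.2 = g.pred p.1 p.2) → (M.Sat φ f ↔ M.Sat φ g)) →
      (∃ (s : Finset ℕ) (t : Finset (ℕ+ × ℕ)), (∀ p ∈ t, ψ.FreePred p.1 p.2) ∧
      ∀ f g : Assignment M, (∀ v ∈ s, f.ind v = g.ind v) →
        (∀ p ∈ t, f.pred p.1 p.2 = g.pred p.1 p.2) → (M.Sat ψ f ↔ M.Sat ψ g)) →
      ∃ (s : Finset ℕ) (t : Finset (ℕ+ × ℕ)), (∀ p ∈ t, (op φ ψ).FreePred p.1 p.2) ∧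
      ∀ f g : Assignment M, (∀ v ∈ s, f.ind v = g.ind v) →
        (∀ p ∈ t, f.pred p.1 p.2 = g.pred p.1 p.2) →
          (M.Sat (op φ ψ) f ↔ M.Sat (op φ ψ) g) := by
    rintro op r φ ψ hop hfree ⟨s₁, t₁, ht₁, h₁⟩ ⟨s₂, t₂, ht₂, h₂⟩
    refine ⟨s₁ ∪ s₂, t₁ ∪ t₂, fun p hp => ?_, fun f g hs ht => ?_⟩
    · rw [hfree]
      exact (Finset.mem_union.1 hp).imp (ht₁ p) (ht₂ p)
    · rw [hop, hop,
        h₁ f g (fun v hv => hs v (Finset.mem_union_left _ hv))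
          (fun p hp => ht p (Finset.mem_union_left _ hp)),
        h₂ f g (fun v hv => hs v (Finset.mem_union_right _ hv))
          (fun p hp => ht p (Finset.mem_union_right _ hp))]
  -- A bound individual variable may stay in `s`, where only finiteness matters; `t` must lose its
  -- bound variables because its members have to be free.
  have ind : ∀ (f g : Assignment M) (s : Finset ℕ) (x : ℕ) (ξ : M.Dom),
      (∀ v ∈ s, f.ind v = g.ind v) → ∀ v ∈ s, (f.setInd x ξ).ind v = (g.setInd x ξ).ind v := by
    intro f g s x ξ h v hv
    simp only [Assignment.setInd, Function.update_apply, h v hv]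
  have pred : ∀ (f g : Assignment M) (t : Finset (ℕ+ × ℕ)) (n : ℕ+) (A : ℕ) (α : M.J n),
      (∀ p ∈ t.erase (n, A), f.pred p.1 p.2 = g.pred p.1 p.2) →
      ∀ p ∈ t, (f.setPred n A α).pred p.1 p.2 = (g.setPred n A α).pred p.1 p.2 := by
    rintro f g t n A α h ⟨k, V⟩ hp
    by_cases hk : n = k ∧ A = V
    · obtain ⟨rfl, rfl⟩ := hk
      simp
    · rw [Assignment.setPred_pred_of_ne f α hk, Assignment.setPred_pred_of_ne g α hk]
      refine h (k, V) (Finset.mem_erase.2 ⟨fun e => hk ?_, hp⟩)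
      rw [Prod.mk.injEq] at e
      exact ⟨e.1.symm, e.2.symm⟩
  have erase : ∀ (φ : Formula) (t : Finset (ℕ+ × ℕ)) (n : ℕ+) (A : ℕ),
      (∀ p ∈ t, φ.FreePred p.1 p.2) →
      ∀ p ∈ t.erase (n, A), ¬(n = p.1 ∧ A = p.2) ∧ φ.FreePred p.1 p.2 := by
    intro φ t n A h p hp
    rw [Finset.mem_erase] at hp
    exact ⟨fun e => hp.1 (Prod.ext e.1.symm e.2.symm), h p hp.2⟩
  induction φ with
  | eq x y =>
    refine ⟨{x, y}, ∅, by simp, fun f g hs _ => ?_⟩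
    simp [Sat, hs x (by simp), hs y (by simp)]
  | predEq n A B =>
    refine ⟨∅, {(n, A), (n, B)}, by simp [Formula.FreePred], fun f g _ ht => ?_⟩
    simp [Sat, ht (n, A) (by simp), ht (n, B) (by simp)]
  | app n A x =>
    refine ⟨Finset.univ.image x, {(n, A)}, by simp [Formula.FreePred], fun f g hs ht => ?_⟩
    have h : (fun i => f.ind (x i)) = fun i => g.ind (x i) :=
      funext fun i => hs (x i) (Finset.mem_image_of_mem x (Finset.mem_univ i))
    simp [Sat, ht (n, A) (by simp), h]
  | neg φ ih =>
    obtain ⟨s, t, ht, h⟩ := ih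
    exact ⟨s, t, ht, fun f g hf hg => not_congr (h f g hf hg)⟩
  | and φ ψ ih₁ ih₂ => exact binary _ _ _ _ (fun _ => Iff.rfl) (fun _ _ => Iff.rfl) ih₁ ih₂
  | or φ ψ ih₁ ih₂ => exact binary _ _ _ _ (fun _ => Iff.rfl) (fun _ _ => Iff.rfl) ih₁ ih₂
  | imp φ ψ ih₁ ih₂ =>
    exact binary _ (fun a b => a → b) _ _ (fun _ => Iff.rfl) (fun _ _ => Iff.rfl) ih₁ ih₂
  | iff φ ψ ih₁ ih₂ => exact binary _ _ _ _ (fun _ => Iff.rfl) (fun _ _ => Iff.rfl) ih₁ ih₂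
  | all x φ ih =>
    obtain ⟨s, t, ht, h⟩ := ih
    exact ⟨s, t, ht, fun f g hf hg => forall_congr' fun ξ => h _ _ (ind f g s x ξ hf) hg⟩
  | ex x φ ih =>
    obtain ⟨s, t, ht, h⟩ := ih
    exact ⟨s, t, ht, fun f g hf hg => exists_congr fun ξ => h _ _ (ind f g s x ξ hf) hg⟩
  | allPred n A φ ih =>
    obtain ⟨s, t, ht, h⟩ := ih
    exact ⟨s, t.erase (n, A), erase φ t n A ht, fun f g hf hg =>
      forall_congr' fun α => h _ _ hf (pred f g t n A α hg)⟩
  | exPred n A φ ih =>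
    obtain ⟨s, t, ht, h⟩ := ih
    exact ⟨s, t.erase (n, A), erase φ t n A ht, fun f g hf hg =>
      exists_congr fun α => h _ _ hf (pred f g t n A α hg)⟩

theorem sat_congr_of_freePred {φ : Formula} {f g : Assignment M} (hi : f.ind = g.ind)
    (hp : ∀ k V, φ.FreePred k V → f.pred k V = g.pred k V) : M.Sat φ f ↔ M.Sat φ g := by
  obtain ⟨s, t, ht, h⟩ := M.exists_finset_sat_congr φ
  exact h f g (fun v _ => congrFun hi v) fun p hp' => hp _ _ (ht p hp')

/-- The argument `(ξ, η)` of an `(n + m)`-ary predicate. -/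
def joinTuple {I : Type} (n m : ℕ+) (ξ : Fin n → I) (η : Fin m → I) : Fin (n + m : ℕ+) → I :=
  fun i => Fin.append ξ η (Fin.cast (PNat.add_coe n m) i)

theorem sat_app₂ (n m : ℕ+) (S : ℕ) (x : Fin n → ℕ) (y : Fin m → ℕ) (f : Assignment M) :
    M.Sat (.app₂ n m S x y) f ↔
      (f.pred (n + m) S).1 (joinTuple n m (fun i => f.ind (x i)) fun i => f.ind (y i)) := by
  have : (fun i => f.ind (Fin.append x y (Fin.cast (PNat.add_coe n m) i)))
      = joinTuple n m (fun i => f.ind (x i)) fun i => f.ind (y i) := by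
    funext i
    unfold joinTuple
    refine Fin.addCases (fun j => ?_) (fun j => ?_) (Fin.cast (PNat.add_coe n m) i) <;> simp
  simp only [Formula.app₂, Sat]
  rw [← this]

theorem sat_ackermann {n m : ℕ+} {x : Fin n → ℕ} {y : Fin m → ℕ} {D S : ℕ} {H : Formula}
    (hx : x.Injective) (hy : y.Injective) (hxy : ∀ i j, x i ≠ y j)
    (hS : ¬ H.FreePred (n + m) S) (f : Assignment M) :
    M.Sat (ackermann n m x y D S H) f ↔
      ((∀ ξ, ∃ δ : M.J m, M.Sat H ((f.setTuple x ξ).setPred m D δ)) →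
        ∃ σ : M.J (n + m), ∀ ξ, ∃ δ : M.J m, (∀ η, δ.1 η ↔ σ.1 (joinTuple n m ξ η)) ∧
          M.Sat H ((f.setTuple x ξ).setPred m D δ)) := by
  -- As `n ≥ 1`, the variables `D` and `S` have different arities, so setting one leaves the other
  -- alone.
  have hne : ∀ V, ¬(m = n + m ∧ D = V) := fun V h => by
    have := congrArg PNat.val h.1
    have := n.pos
    simp at *
  unfold ackermann
  simp only [Sat, sat_allTuple M hx, sat_allTuple M hy]
  refine imp_congr Iff.rfl (exists_congr fun σ => forall_congr' fun ξ => exists_congr fun δ =>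
    and_congr (forall_congr' fun η => ?_) ?_)
  · rw [sat_app₂]
    have h₁ : (fun i => ((((f.setPred (n + m) S σ).setTuple x ξ).setPred m D δ).setTuple y η).ind
        (y i)) = η := funext fun i => Assignment.setTuple_ind_apply _ hy η i
    have h₂ : (fun i => ((((f.setPred (n + m) S σ).setTuple x ξ).setPred m D δ).setTuple y η).ind
        (x i)) = ξ := funext fun i => by
      rw [Assignment.setTuple_ind_of_ne _ _ fun j h => hxy i j h.symm]
      exact Assignment.setTuple_ind_apply _ hx ξ i
    rw [h₁, h₂]
    simp [Assignment.setPred_pred_of_ne _ _ (hne S)]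
  -- The two assignments can differ only at `S`, which is not free in `H`.
  · refine M.sat_congr_of_freePred rfl fun k V hV => ?_
    by_cases hk : m = k ∧ D = V
    · obtain ⟨rfl, rfl⟩ := hk
      simp
    · rw [Assignment.setPred_pred_of_ne _ _ hk, Assignment.setPred_pred_of_ne _ _ hk]
      refine Assignment.setPred_pred_of_ne _ _ fun h => hS ?_
      rw [h.1, h.2]
      exact hV

/-- There is a predicate of `M` that is the graph of a one-to-one function of `α` into `β`. -/
def Embeds {n : ℕ+} (α β : M.J n) : Prop :=
  ∃ σ : M.J (n + n),
    (∀ ξ η, σ.1 (joinTuple n n ξ η) → α.1 ξ ∧ β.1 η) ∧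
    (∀ ξ, α.1 ξ → ∃ η, σ.1 (joinTuple n n ξ η)) ∧
    (∀ ξ η ζ, σ.1 (joinTuple n n ξ η) → σ.1 (joinTuple n n ξ ζ) → η = ζ) ∧
    (∀ ξ η ζ, σ.1 (joinTuple n n ξ ζ) → σ.1 (joinTuple n n η ζ) → ξ = η)

theorem sat_embeds (n : ℕ+) (A B : ℕ) (f : Assignment M) :
    M.Sat (embeds n A B) f ↔ M.Embeds (f.pred n A) (f.pred n B) := by
  -- The quantified `2n`-ary variable has number `0`, like an `n`-ary one, but its arity separates
  -- them.
  have hne : ∀ V W : ℕ, ¬(n + n = n ∧ V = W) := fun V W h => by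
    have := congrArg PNat.val h.1
    have := n.pos
    simp at *
  set x : Fin n → ℕ := fun i => i with hxdef
  set y : Fin n → ℕ := fun i => n + i with hydef
  set z : Fin n → ℕ := fun i => 2 * n + i with hzdef
  have hx : x.Injective := fun i j h => Fin.ext (by simpa [x] using h)
  have hy : y.Injective := fun i j h => Fin.ext (by simpa [y] using h)
  have hz : z.Injective := fun i j h => Fin.ext (by simpa [z] using h)
  have hyx : ∀ i j, y j ≠ x i := fun i j => by simp only [x, y]; omega
  have hzx : ∀ i j, z j ≠ x i := fun i j => by simp only [x, z]; omega
  have hzy : ∀ i j, z j ≠ y i := fun i j => by simp only [y, z]; omega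
  have ex : ∀ (g : Assignment M) ξ i, (g.setTuple x ξ).ind (x i) = ξ i :=
    fun g ξ i => Assignment.setTuple_ind_apply g hx ξ i
  have ey : ∀ (g : Assignment M) ξ i, (g.setTuple y ξ).ind (y i) = ξ i :=
    fun g ξ i => Assignment.setTuple_ind_apply g hy ξ i
  have ez : ∀ (g : Assignment M) ξ i, (g.setTuple z ξ).ind (z i) = ξ i :=
    fun g ξ i => Assignment.setTuple_ind_apply g hz ξ i
  have eyx : ∀ (g : Assignment M) ξ i, (g.setTuple y ξ).ind (x i) = g.ind (x i) :=
    fun g ξ i => Assignment.setTuple_ind_of_ne g ξ fun j => hyx i j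
  have ezx : ∀ (g : Assignment M) ξ i, (g.setTuple z ξ).ind (x i) = g.ind (x i) :=
    fun g ξ i => Assignment.setTuple_ind_of_ne g ξ fun j => hzx i j
  have ezy : ∀ (g : Assignment M) ξ i, (g.setTuple z ξ).ind (y i) = g.ind (y i) :=
    fun g ξ i => Assignment.setTuple_ind_of_ne g ξ fun j => hzy i j
  unfold embeds Embeds
  simp only [← hxdef, ← hydef, ← hzdef, Sat, sat_allTuple M hx, sat_allTuple M hy,
    sat_allTuple M hz, sat_exTuple M hy, sat_app₂, sat_eqTuple, ex, ey, ez, eyx, ezx, ezy,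
    Assignment.setTuple_pred, Assignment.setPred_pred_self, funext_iff, and_imp,
    Assignment.setPred_pred_of_ne f _ (hne _ _)]

theorem sat_trichotomy (n : ℕ+) (f : Assignment M) :
    M.Sat (trichotomy n) f ↔ ∀ α β : M.J n, M.Embeds α β ∨ M.Embeds β α := by
  refine forall_congr' fun α => forall_congr' fun β => ?_
  have h₀ : ((f.setPred n 0 α).setPred n 1 β).pred n 0 = α := by
    rw [Assignment.setPred_pred_of_ne _ _ (by simp), Assignment.setPred_pred_self]
  refine or_congr ?_ ?_ <;>
    rw [sat_embeds, h₀, Assignment.setPred_pred_self]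

end PredStructure

open PredStructure

/-! ### The full structure over `ℕ`, where trichotomy holds -/

/-- The first part of an `(n + m)`-tuple. -/
def tupleFst {I : Type} (n m : ℕ+) (ζ : Fin (n + m : ℕ+) → I) : Fin n → I :=
  fun i => ζ (Fin.cast (PNat.add_coe n m).symm (Fin.castAdd m i))

/-- The second part of an `(n + m)`-tuple. -/
def tupleSnd {I : Type} (n m : ℕ+) (ζ : Fin (n + m : ℕ+) → I) : Fin m → I :=
  fun i => ζ (Fin.cast (PNat.add_coe n m).symm (Fin.natAdd n i))

@[simp] theorem tupleFst_joinTuple {I : Type} (n m : ℕ+) (ξ : Fin n → I) (η : Fin m → I) :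
    tupleFst n m (joinTuple n m ξ η) = ξ := by
  funext i
  simp [tupleFst, joinTuple]

@[simp] theorem tupleSnd_joinTuple {I : Type} (n m : ℕ+) (ξ : Fin n → I) (η : Fin m → I) :
    tupleSnd n m (joinTuple n m ξ η) = η := by
  funext i
  simp [tupleSnd, joinTuple]

/-- The standard structure over `ℕ`, with all predicates. -/
abbrev standardNat : PredStructure where
  Dom := ℕ
  nonempty_dom := ⟨0⟩
  J _ := Set.univ
  nonempty_J _ := Set.univ_nonempty

theorem standardNat_isHenkin : standardNat.IsHenkin := fun _ _ _ _ _ => Set.mem_univ _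

theorem standardNat_valid_choice : ∀ γ ∈ choiceAll, standardNat.Valid γ := by
  intro γ hγ f
  simp only [choiceAll, Set.mem_iUnion] at hγ
  obtain ⟨n, m, x, y, D, S, H, hx, hy, hxy, -, -, hS, rfl⟩ := hγ
  rw [sat_ackermann _ hx hy hxy hS]
  intro h
  choose δ hδ using h
  exact ⟨⟨fun ζ => (δ (tupleFst n m ζ)).1 (tupleSnd n m ζ), Set.mem_univ _⟩,
    fun ξ => ⟨δ ξ, fun η => by simp, hδ ξ⟩⟩

theorem standardNat_embeds_of_embedding {n : ℕ+} {α β : standardNat.J n}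
    (e : {ξ // α.1 ξ} ↪ {η // β.1 η}) : standardNat.Embeds α β := by
  refine ⟨⟨fun ζ => ∃ h : α.1 (tupleFst n n ζ), (e ⟨_, h⟩).1 = tupleSnd n n ζ, Set.mem_univ _⟩,
    ?_, ?_, ?_, ?_⟩
  all_goals simp only [tupleFst_joinTuple, tupleSnd_joinTuple]
  · rintro ξ η ⟨h, h'⟩
    exact ⟨h, h' ▸ (e _).2⟩
  · exact fun ξ h => ⟨(e ⟨ξ, h⟩).1, h, rfl⟩
  · rintro ξ η ζ ⟨h, h₁⟩ ⟨_, h₂⟩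
    exact h₁.symm.trans h₂
  · rintro ξ η ζ ⟨h, h₁⟩ ⟨h', h₂⟩
    exact congrArg Subtype.val (e.injective (Subtype.ext (h₁.trans h₂.symm)))

theorem standardNat_valid_trichotomy (n : ℕ+) : standardNat.Valid (trichotomy n) := by
  intro f
  rw [sat_trichotomy]
  intro α β
  rcases Function.Embedding.total {ξ // α.1 ξ} {η // β.1 η} with ⟨⟨e⟩⟩ | ⟨⟨e⟩⟩
  · exact Or.inl (standardNat_embeds_of_embedding e)
  · exact Or.inr (standardNat_embeds_of_embedding e)

/-! ### Colour-preserving permutations and finite supports -/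

/-- The individuals of the permutation model: infinitely many in each of two colours. -/
abbrev Atom : Type := Bool × ℕ

/-- The group of permutations of the individuals that preserve the colour. -/
def colourPerm : Subgroup (Equiv.Perm Atom) where
  carrier := {π | ∀ a, (π a).1 = a.1}
  mul_mem' {π ρ} hπ hρ a := (hπ (ρ a)).trans (hρ a)
  one_mem' _ := rfl
  inv_mem' {π} hπ a := by
    have := hπ (π⁻¹ a)
    rwa [show π (π⁻¹ a) = a from Equiv.apply_symm_apply π a, eq_comm] at this

theorem smul_fst (π : colourPerm) (a : Atom) : (π • a).1 = a.1 := π.2 a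

/-- The transposition of two individuals of the same colour. -/
def colourSwap (a b : Atom) (h : a.1 = b.1) : colourPerm :=
  ⟨Equiv.swap a b, fun c => by
    rw [Equiv.swap_apply_def]
    split_ifs with h₁ h₂
    · rw [h₁, h]
    · rw [h₂, h]
    · rfl⟩

theorem colourSwap_smul_left (a b : Atom) (h : a.1 = b.1) : colourSwap a b h • a = b :=
  Equiv.swap_apply_left a b

theorem colourSwap_smul_of_ne {a b c : Atom} (h : a.1 = b.1) (ha : c ≠ a) (hb : c ≠ b) :
    colourSwap a b h • c = c :=
  Equiv.swap_apply_of_ne_of_ne ha hb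

theorem exists_notMem_fst (E : Finset Atom) (c : Bool) : ∃ a ∉ E, a.1 = c := by
  obtain ⟨k, hk⟩ := Infinite.exists_notMem_finset (E.image Prod.snd)
  exact ⟨(c, k), fun h => hk (Finset.mem_image_of_mem Prod.snd h), rfl⟩

/-- `π` fixes all elements of `E`. -/
def Fixes (π : colourPerm) (E : Finset Atom) : Prop := ∀ a ∈ E, π • a = a

theorem Fixes.mono {π : colourPerm} {E F : Finset Atom} (h : Fixes π F) (hEF : E ⊆ F) :
    Fixes π E := fun a ha => h a (hEF ha)

theorem Fixes.inv {π : colourPerm} {E : Finset Atom} (h : Fixes π E) : Fixes π⁻¹ E :=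
  fun a ha => by rw [inv_smul_eq_iff, h a ha]

/-- The predicate `P` has a finite support. -/
def FinSupp {Y : Type} [MulAction colourPerm Y] (P : Y → Prop) : Prop :=
  ∃ E : Finset Atom, ∀ π : colourPerm, Fixes π E → ∀ y, P (π • y) ↔ P y

/-- If `E` supports `P`, its image under `π` supports the translate: conjugation by `π` turns
permutations fixing the image into permutations fixing `E`. -/
theorem FinSupp.smul {Y : Type} [MulAction colourPerm Y] {P : Y → Prop} (h : FinSupp P)
    (π : colourPerm) : FinSupp fun y => P (π⁻¹ • y) := by
  classical
  obtain ⟨E, hE⟩ := h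
  refine ⟨E.image fun a => π • a, fun ρ hρ y => ?_⟩
  have := hE (π⁻¹ * ρ * π) (fun a ha => by
    rw [mul_smul, mul_smul, hρ _ (Finset.mem_image_of_mem _ ha), inv_smul_smul]) (π⁻¹ • y)
  simpa [mul_smul] using this

/-! ### Choice of finitely supported predicates -/

section Choice

variable {Y : Type} [MulAction colourPerm Y]

/-- Choice for families of finitely supported predicates indexed by individuals. -/
theorem exists_finSupp_choice (E : Finset Atom) (R : Atom → (Y → Prop) → Prop)
    (hR : ∀ π, Fixes π E → ∀ x P, R x P → R (π • x) fun y => P (π⁻¹ • y))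
    (h : ∀ x, ∃ P, FinSupp P ∧ R x P) :
    ∃ S : Atom × Y → Prop, FinSupp S ∧ ∀ x, R x fun y => S (x, y) := by
  classical
  choose P hP hRP using h
  choose F hF using hP
  -- `r c` is the representative of colour `c`, taken outside `E`.
  choose r hrE hrc using exists_notMem_fst E
  set F' : Finset Atom := E ∪ (F (r true) ∪ F (r false)) with hF'
  have hFr : ∀ c, F (r c) ⊆ F' := by
    intro c a ha
    cases c <;> simp [hF', ha]
  -- On the finite set `F'` the arbitrary choice `P x` is kept; elsewhere the predicate chosen for
  -- the representative is carried to `x` by a transposition. The support consists of `F'` and the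
  -- supports of the finitely many kept predicates.
  refine ⟨fun p => if p.1 ∈ F' then P p.1 p.2 else
    P (r p.1.1) ((colourSwap (r p.1.1) p.1 (hrc _))⁻¹ • p.2), ⟨F' ∪ F'.biUnion F, ?_⟩, ?_⟩
  · rintro π hπ ⟨x, y⟩
    have hπ' : Fixes π F' := hπ.mono Finset.subset_union_left
    by_cases hx : x ∈ F'
    · simp only [Prod.smul_mk, hπ' x hx, hx, if_true]
      exact hF x π (hπ.mono ((Finset.subset_biUnion_of_mem F hx).trans
        Finset.subset_union_right)) y
    · have hx' : π • x ∉ F' := fun hmem => by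
        have := hπ' _ hmem
        rw [smul_left_cancel_iff] at this
        exact hx (this ▸ hmem)
      simp only [Prod.smul_mk, hx, hx', if_false]
      have key : ∀ c (h₁ : (r c).1 = x.1) (h₂ : (r c).1 = (π • x).1),
          P (r c) ((colourSwap (r c) (π • x) h₂)⁻¹ • π • y) ↔
            P (r c) ((colourSwap (r c) x h₁)⁻¹ • y) := by
        intro c h₁ h₂
        -- This product maps `r c` to `x`, then to `π • x`, then back to `r c`. Any other point of
        -- `F (r c)` lies in `F'`, hence is fixed by all three factors, so the product fixes the
        -- support of `P (r c)`.
        have := hF (r c) ((colourSwap (r c) (π • x) h₂)⁻¹ * π * colourSwap (r c) x h₁)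
          (fun z hz => ?_) ((colourSwap (r c) x h₁)⁻¹ • y)
        · simpa [mul_smul] using this
        · rw [mul_smul, mul_smul, inv_smul_eq_iff]
          by_cases hzr : z = r c
          · rw [hzr, colourSwap_smul_left, colourSwap_smul_left]
          · have hzF : z ∈ F' := hFr c hz
            have hzx : z ≠ x := fun h => hx (h ▸ hzF)
            have hzx' : z ≠ π • x := fun h => hx' (h ▸ hzF)
            rw [colourSwap_smul_of_ne _ hzr hzx, hπ' z hzF,
              colourSwap_smul_of_ne _ hzr hzx']
      have hc := smul_fst π x
      rw [← key x.1 (hrc _) ((hrc _).trans hc.symm)]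
      -- The colours of `π • x` and `x` are only provably equal, and the proof inside `colourSwap`
      -- depends on them; generalizing the colour permits the substitution.
      have : ∀ c (hc : c = x.1) (h₂ : (r c).1 = (π • x).1),
          P (r c) ((colourSwap (r c) (π • x) h₂)⁻¹ • π • y) ↔
          P (r x.1) ((colourSwap (r x.1) (π • x) (hc ▸ h₂))⁻¹ • π • y) := by
        rintro c rfl h₂
        rfl
      exact this _ hc (hrc _)
  · intro x
    by_cases hx : x ∈ F'
    · simpa only [hx, if_true] using hRP x
    · simp only [hx, if_false]
      have hxE : x ∉ E := fun h => hx (Finset.mem_union_left _ h)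
      have := hR (colourSwap (r x.1) x (hrc _))
        (fun a ha => colourSwap_smul_of_ne _ (fun e => hrE x.1 (e ▸ ha)) fun e => hxE (e ▸ ha))
        -- The transposition fixes `E`, as neither `r x.1` nor `x` belongs to it, so `hR` applies.
        _ _ (hRP (r x.1))
      rwa [colourSwap_smul_left] at this

end Choice

/-- Choice for families of finitely supported predicates indexed by tuples of individuals. -/
theorem exists_finSupp_choice_tuple (n : ℕ) {Y : Type} [MulAction colourPerm Y]
    (E : Finset Atom) (R : (Fin n → Atom) → (Y → Prop) → Prop)
    (hR : ∀ π, Fixes π E → ∀ ξ P, R ξ P → R (π • ξ) fun y => P (π⁻¹ • y))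
    (h : ∀ ξ, ∃ P, FinSupp P ∧ R ξ P) :
    ∃ S : (Fin n → Atom) × Y → Prop, FinSupp S ∧ ∀ ξ, R ξ fun y => S (ξ, y) := by
  classical
  induction n generalizing E with
  | zero =>
    obtain ⟨P, ⟨F, hF⟩, hP⟩ := h Fin.elim0
    refine ⟨fun p => P p.2, ⟨F, fun π hπ p => hF π hπ p.2⟩, fun ξ => ?_⟩
    rwa [Subsingleton.elim ξ Fin.elim0]
  | succ n ih =>
    have smul_cons : ∀ (π : colourPerm) (x : Atom) (ξ : Fin n → Atom),
        π • (Fin.cons x ξ : Fin (n + 1) → Atom) = Fin.cons (π • x) (π • ξ) := by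
      intro π x ξ
      funext i
      refine Fin.cases ?_ (fun j => ?_) i <;> simp
    -- For a fixed head `x`, induction with the enlarged support `insert x E` chooses for all tails
    -- at once. The result is one predicate on tails and `Y`, so a single choice over `x` remains.
    obtain ⟨S, ⟨F, hF⟩, hS⟩ := exists_finSupp_choice (Y := (Fin n → Atom) × Y) E
      (fun x Q => ∀ ξ, R (Fin.cons x ξ) fun y => Q (ξ, y))
      (fun π hπ x Q hQ ξ => by
        have := hR π hπ _ _ (hQ (π⁻¹ • ξ))
        rwa [smul_cons, smul_inv_smul] at this)
      (fun x => ih (insert x E) (fun ξ => R (Fin.cons x ξ))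
        (fun π hπ ξ P hP => by
          have := hR π (hπ.mono (Finset.subset_insert _ _)) _ _ hP
          rwa [smul_cons, hπ x (Finset.mem_insert_self _ _)] at this)
        fun ξ => h _)
    refine ⟨fun p => S (p.1 0, (Fin.tail p.1, p.2)),
      ⟨F, fun π hπ p => hF π hπ (p.1 0, (Fin.tail p.1, p.2))⟩, fun ξ => ?_⟩
    have := hS (ξ 0) (Fin.tail ξ)
    rwa [Fin.cons_self_tail] at this

/-! ### The Fraenkel structure: comprehension and choice -/

/-- The two-coloured basic Fraenkel structure: the predicates are those with a finite support. -/
abbrev fraenkel : PredStructure where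
  Dom := Atom
  nonempty_dom := ⟨(true, 0)⟩
  J n := {P : (Fin n → Atom) → Prop | FinSupp P}
  nonempty_J _ := ⟨fun _ => True, ∅, fun _ _ _ => Iff.rfl⟩

/-- The image of a finitely supported predicate under a permutation. -/
def permPred (π : colourPerm) {n : ℕ+} (α : fraenkel.J n) : fraenkel.J n :=
  ⟨fun ξ : Fin n → Atom => α.1 (π⁻¹ • ξ), FinSupp.smul α.2 π⟩

theorem permPred_permPred_inv (π : colourPerm) {n : ℕ+} (α : fraenkel.J n) :
    permPred π (permPred π⁻¹ α) = α :=
  Subtype.ext (funext fun ξ : Fin n → Atom =>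
    congrArg α.1 (show π⁻¹⁻¹ • π⁻¹ • ξ = ξ by rw [inv_inv, smul_inv_smul]))

theorem permPred_inv_permPred (π : colourPerm) {n : ℕ+} (α : fraenkel.J n) :
    permPred π⁻¹ (permPred π α) = α := by
  have := permPred_permPred_inv π⁻¹ α
  rwa [inv_inv] at this

/-- The image of an assignment under a permutation. -/
def permAssign (π : colourPerm) (f : Assignment fraenkel) : Assignment fraenkel :=
  ⟨fun v => (π • (f.ind v : Atom) : Atom), fun n V => permPred π (f.pred n V)⟩

theorem permAssign_setInd (π : colourPerm) (f : Assignment fraenkel) (x : ℕ) (ξ : Atom) :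
    permAssign π (f.setInd x ξ) = (permAssign π f).setInd x (π • ξ : Atom) := by
  have : (permAssign π (f.setInd x ξ)).ind = ((permAssign π f).setInd x (π • ξ : Atom)).ind := by
    funext v
    by_cases h : v = x
    · subst h
      simp [permAssign, Assignment.setInd]
    · simp [permAssign, Assignment.setInd, Function.update_of_ne h]
  exact congrArg (fun i => (⟨i, (permAssign π f).pred⟩ : Assignment fraenkel)) this

theorem permAssign_setPred (π : colourPerm) (f : Assignment fraenkel) (n : ℕ+) (A : ℕ)
    (α : fraenkel.J n) :
    permAssign π (f.setPred n A α) = (permAssign π f).setPred n A (permPred π α) := by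
  have : (permAssign π (f.setPred n A α)).pred
      = ((permAssign π f).setPred n A (permPred π α)).pred := by
    funext k V
    by_cases h : n = k ∧ A = V
    · obtain ⟨rfl, rfl⟩ := h
      simp [permAssign]
    · rw [Assignment.setPred_pred_of_ne _ _ h]
      simp [permAssign, Assignment.setPred_pred_of_ne _ _ h]
  exact congrArg (fun i => (⟨(permAssign π f).ind, i⟩ : Assignment fraenkel)) this

theorem permAssign_setTuple (π : colourPerm) (f : Assignment fraenkel) {n : ℕ}
    (x : Fin n → ℕ) (hx : x.Injective) (ξ : Fin n → Atom) :
    permAssign π (f.setTuple x ξ) = (permAssign π f).setTuple x (π • ξ : Fin n → Atom) := by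
  have : (permAssign π (f.setTuple x ξ)).ind
      = ((permAssign π f).setTuple x (π • ξ : Fin n → Atom)).ind := by
    funext v
    by_cases h : ∃ i, x i = v
    · obtain ⟨i, rfl⟩ := h
      rw [Assignment.setTuple_ind_apply _ hx]
      exact congrArg (fun a : Atom => π • a) (Assignment.setTuple_ind_apply f hx ξ i)
    · push Not at h
      rw [Assignment.setTuple_ind_of_ne _ _ h]
      exact congrArg (fun a : Atom => π • a) (Assignment.setTuple_ind_of_ne f ξ h)
  exact congrArg (fun i => (⟨i, (permAssign π f).pred⟩ : Assignment fraenkel)) this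

/-- A permutation acts bijectively on the individuals and on the predicates of each arity, so every
quantifier range is mapped onto itself. -/
theorem sat_permAssign (φ : Formula) (π : colourPerm) (f : Assignment fraenkel) :
    fraenkel.Sat φ (permAssign π f) ↔ fraenkel.Sat φ f := by
  have ind : Function.Surjective fun a : Atom => π • a := MulAction.surjective π
  have pred : ∀ n, Function.Surjective (permPred π (n := n)) :=
    fun n α => ⟨_, permPred_permPred_inv π α⟩
  induction φ generalizing f with
  | eq x y => exact smul_left_cancel_iff (β := Atom) π
  | predEq n A B =>
    refine ⟨fun h => ?_, fun h => congrArg (permPred π) h⟩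
    have := congrArg (permPred π⁻¹) h
    exact (permPred_inv_permPred π _).symm.trans (this.trans (permPred_inv_permPred π _))
  | app n A x =>
    refine iff_of_eq (congrArg (f.pred n A).1 (funext fun i => ?_))
    exact inv_smul_smul π (f.ind (x i) : Atom)
  | neg φ ih => exact not_congr (ih f)
  | and φ ψ ih₁ ih₂ => exact and_congr (ih₁ f) (ih₂ f)
  | or φ ψ ih₁ ih₂ => exact or_congr (ih₁ f) (ih₂ f)
  | imp φ ψ ih₁ ih₂ => exact imp_congr (ih₁ f) (ih₂ f)
  | iff φ ψ ih₁ ih₂ => exact iff_congr (ih₁ f) (ih₂ f)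
  | all x φ ih =>
    refine ind.forall.trans (forall_congr' fun ξ => ?_)
    have := ih (f.setInd x ξ)
    rwa [permAssign_setInd] at this
  | ex x φ ih =>
    refine ind.exists.trans (exists_congr fun ξ => ?_)
    have := ih (f.setInd x ξ)
    rwa [permAssign_setInd] at this
  | allPred n A φ ih =>
    refine (pred n).forall.trans (forall_congr' fun α => ?_)
    have := ih (f.setPred n A α)
    rwa [permAssign_setPred] at this
  | exPred n A φ ih =>
    refine (pred n).exists.trans (exists_congr fun α => ?_)
    have := ih (f.setPred n A α)
    rwa [permAssign_setPred] at this

/-- The free variables of a formula other than the given ones contribute only a finite support. -/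
theorem exists_support (φ : Formula) (f : Assignment fraenkel) :
    ∃ E : Finset Atom, ∀ π, Fixes π E → ∀ {n : ℕ} (x : Fin n → ℕ), x.Injective →
      ∀ ξ : Fin n → Atom,
        (fraenkel.Sat φ (f.setTuple x (π • ξ : Fin n → Atom)) ↔ fraenkel.Sat φ (f.setTuple x ξ)) ∧
        ∀ (m : ℕ+) (D : ℕ) (δ : fraenkel.J m),
          (fraenkel.Sat φ ((f.setTuple x (π • ξ : Fin n → Atom)).setPred m D (permPred π δ)) ↔
            fraenkel.Sat φ ((f.setTuple x ξ).setPred m D δ)) := by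
  classical
  obtain ⟨s, t, -, hst⟩ := fraenkel.exists_finset_sat_congr φ
  choose F hF using fun p : ℕ+ × ℕ => (f.pred p.1 p.2).2
  -- The support collects the values of the finitely many relevant individual variables and supports
  -- of the relevant predicates. A permutation fixing it changes none of these parameters.
  refine ⟨s.image (fun v => (f.ind v : Atom)) ∪ t.biUnion F, fun π hπ n x hx ξ => ?_⟩
  have hind : ∀ v ∈ s, (f.setTuple x (π • ξ : Fin n → Atom)).ind v
      = (permAssign π (f.setTuple x ξ)).ind v := by
    intro v hv
    rw [permAssign_setTuple π f x hx]
    by_cases h : ∃ i, x i = v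
    · obtain ⟨i, rfl⟩ := h
      rw [Assignment.setTuple_ind_apply _ hx, Assignment.setTuple_ind_apply _ hx]
    · push Not at h
      rw [Assignment.setTuple_ind_of_ne _ _ h, Assignment.setTuple_ind_of_ne _ _ h]
      exact (hπ _ (Finset.mem_union_left _ (Finset.mem_image_of_mem _ hv))).symm
  have hpred : ∀ p ∈ t, f.pred p.1 p.2 = permPred π (f.pred p.1 p.2) := by
    intro p hp
    have hfix : Fixes π (F p) :=
      hπ.mono ((Finset.subset_biUnion_of_mem F hp).trans Finset.subset_union_right)
    exact Subtype.ext (funext fun η : Fin p.1 → Atom =>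
      propext (hF p π⁻¹ hfix.inv η).symm)
  refine ⟨?_, fun m D δ => ?_⟩
  · rw [← sat_permAssign φ π (f.setTuple x ξ)]
    exact hst _ _ hind hpred
  · rw [← sat_permAssign φ π ((f.setTuple x ξ).setPred m D δ), permAssign_setPred]
    refine hst _ _ hind fun p hp => ?_
    by_cases h : m = p.1 ∧ D = p.2
    · obtain ⟨rfl, rfl⟩ := h
      simp
    · rw [Assignment.setPred_pred_of_ne _ _ h, Assignment.setPred_pred_of_ne _ _ h]
      exact hpred p hp

theorem fraenkel_isHenkin : fraenkel.IsHenkin := by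
  intro n x hx φ f
  obtain ⟨E, hE⟩ := exists_support φ f
  exact ⟨E, fun π hπ ξ => (hE π hπ x hx ξ).1⟩

theorem fraenkel_valid_choice : ∀ γ ∈ choiceAll, fraenkel.Valid γ := by
  intro γ hγ f
  simp only [choiceAll, Set.mem_iUnion] at hγ
  obtain ⟨n, m, x, y, D, S, H, hx, hy, hxy, -, -, hS, rfl⟩ := hγ
  rw [sat_ackermann _ hx hy hxy hS]
  intro h
  obtain ⟨E, hE⟩ := exists_support H f
  -- The relation packs membership of `P` in the structure together with `H`; its invariance under
  -- permutations fixing `E` comes from `exists_support`.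
  obtain ⟨s, ⟨F, hF⟩, hs⟩ := exists_finSupp_choice_tuple n (Y := Fin m → Atom) E
    (fun ξ P => ∃ hP : FinSupp P, fraenkel.Sat H ((f.setTuple x ξ).setPred m D ⟨P, hP⟩))
    (fun π hπ ξ P ⟨hP, hsat⟩ => ⟨hP.smul π, ((hE π hπ x hx ξ).2 m D ⟨P, hP⟩).2 hsat⟩)
    (fun ξ => by
      obtain ⟨δ, hδ⟩ := h ξ
      exact ⟨δ.1, δ.2, δ.2, hδ⟩)
  refine ⟨⟨fun ζ : Fin (n + m : ℕ+) → Atom => s (tupleFst n m ζ, tupleSnd n m ζ),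
    F, fun π hπ ζ => hF π hπ (tupleFst n m ζ, tupleSnd n m ζ)⟩, fun ξ => ?_⟩
  obtain ⟨hP, hsat⟩ := hs ξ
  exact ⟨⟨_, hP⟩, fun η => by simp, hsat⟩

/-! ### Failure of trichotomy and conclusion -/

/-- The predicate that holds of the constant tuples of colour `c`. -/
def diagonal (n : ℕ+) (c : Bool) : fraenkel.J n :=
  ⟨fun ξ : Fin n → Atom => ∃ a : Atom, a.1 = c ∧ ξ = fun _ => a, ∅, fun π _ ξ => by
    constructor
    · rintro ⟨a, ha, h⟩
      refine ⟨π⁻¹ • a, (smul_fst _ _).trans ha, ?_⟩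
      rw [← inv_smul_smul π ξ, h]
      rfl
    · rintro ⟨a, ha, rfl⟩
      exact ⟨π • a, (smul_fst _ _).trans ha, rfl⟩⟩

/-- Take distinct `a`, `b` of colour `c` outside a support of the injection. Their transposition
fixes that support and every individual of colour `d`, so the constant tuples of `a` and `b` get the
same image. -/
theorem not_embeds_diagonal (n : ℕ+) {c d : Bool} (hcd : c ≠ d) :
    ¬ fraenkel.Embeds (diagonal n c) (diagonal n d) := by
  rintro ⟨⟨σ, E, hE⟩, hdom, htot, -, hinj⟩
  obtain ⟨a, haE, hac⟩ := exists_notMem_fst E c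
  obtain ⟨b, hbE, hbc⟩ := exists_notMem_fst (insert a E) c
  rw [Finset.mem_insert, not_or] at hbE
  obtain ⟨η, hη⟩ := htot (fun _ => a) ⟨a, hac, rfl⟩
  obtain ⟨-, e, hed, rfl⟩ := hdom _ _ hη
  have hab : a.1 = b.1 := hac.trans hbc.symm
  have hfix : Fixes (colourSwap a b hab) E := fun z hz =>
    colourSwap_smul_of_ne hab (fun h => haE (h ▸ hz)) fun h => hbE.2 (h ▸ hz)
  have he : colourSwap a b hab • e = e := colourSwap_smul_of_ne hab
    (fun h => hcd (by rw [← hac, ← hed, h])) fun h => hcd (by rw [← hbc, ← hed, h])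
  have hsmul : colourSwap a b hab • (joinTuple n n (fun _ => a) fun _ => e :
      Fin (n + n : ℕ+) → Atom) = joinTuple n n (fun _ => b) fun _ => e := by
    funext i
    unfold joinTuple
    rw [Pi.smul_apply]
    refine Fin.addCases (fun j => ?_) (fun j => ?_) (Fin.cast (PNat.add_coe n n) i)
    · rw [Fin.append_left, Fin.append_left, colourSwap_smul_left]
    · rw [Fin.append_right, Fin.append_right, he]
  have hη' : σ (joinTuple n n (fun _ => b) fun _ => e) := by
    rw [← hsmul]
    exact (hE _ hfix _).2 hη
  exact hbE.1 (congrFun (hinj _ _ _ hη' hη) ⟨0, n.pos⟩)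

theorem fraenkel_not_sat_trichotomy (n : ℕ+) (f : Assignment fraenkel) :
    ¬ fraenkel.Sat (trichotomy n) f := by
  rw [sat_trichotomy]
  intro h
  rcases h (diagonal n true) (diagonal n false) with h | h
  · exact not_embeds_diagonal n (by simp) h
  · exact not_embeds_diagonal n (by simp) h

/-- Validity quantifies over assignments, so one must exist before it can be contradicted. -/
instance (M : PredStructure) : Nonempty (Assignment M) := by
  obtain ⟨a⟩ := M.nonempty_dom
  exact ⟨⟨fun _ => a, fun n _ => ⟨_, (M.nonempty_J n).some_mem⟩⟩⟩

end HPL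

theorem mainTheorem5 (n : ℕ+) : HPL.Independent (HPL.trichotomy n) HPL.choiceAll := by
  constructor
  · intro h
    obtain ⟨f⟩ : Nonempty (HPL.Assignment HPL.fraenkel) := inferInstance
    exact HPL.fraenkel_not_sat_trichotomy n f
      (h _ HPL.fraenkel_isHenkin HPL.fraenkel_valid_choice f)
  · intro h
    obtain ⟨f⟩ : Nonempty (HPL.Assignment HPL.standardNat) := inferInstance
    exact h _ HPL.standardNat_isHenkin HPL.standardNat_valid_choice f
      (HPL.standardNat_valid_trichotomy n f)
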